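/- Let $X$ be a (real) Fréchet space and let $f,g:X\to\mathbb R\cup\{\pm\infty\}$ be proper, convex and lower semicontinuous (lsc) functions, where proper means that $\operatorname{dom} f=\{x: f(x)<+\infty\}$ is nonempty and $f>-\infty$ everywhere. Put $v(P_F)=\inf_{x\in X}\{f(x)+g(x)\}$, $\operatorname{epi} f=\{(x,r)\in X\times\mathbb R: f(x)\le r\}$ and $\widehat{\operatorname{epi}}\,f=\{(x,r)\in X\times\mathbb R: f(x)\le -r\}$; differences of sets are Minkowski differences. For a convex set $U$ in a separated locally convex space $Z$, with $\operatorname{cone}(U)=\bigcup_{t\ge 0}tU$, let $$\operatorname{core}(U)=\{x\in U:\operatorname{cone}(U-x)=Z\},\qquad \operatorname{qi}(U)=\{x\in U:\operatorname{cl}(\operatorname{cone}(U-x))=Z\},$$ $$\operatorname{qri}(U)=\{x\in U:\operatorname{cl}(\operatorname{cone}(U-x))\text{ is a linear subspace of }Z\}.$$ When $v(P_F)\in\mathbb R$, let $E=\operatorname{co}\big[\big(\operatorname{epi} f-\widehat{\operatorname{epi}}(g-v(P_F))\big)\cup\{(0,0)\}\big]\subseteq X\times\mathbb R$, where $\operatorname{co}$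 is the convex hull. Consider the conditions - $(RC_1^F)$: there is $x'\in\operatorname{dom} f\cap\operatorname{dom} g$ such that $f$ or $g$ is continuous at $x'$; - $(RC_2^F)$: $X$ is a Fréchet space, $f,g$ are lsc and $0\in\operatorname{int}(\operatorname{dom} f-\operatorname{dom} g)$; - $(RC_3^F)$: $X$ is a Fréchet space, $f,g$ are lsc and $0\in\operatorname{core}(\operatorname{dom} f-\operatorname{dom} g)$; - $(RC_6^F)$: $0\in\operatorname{qi}(\operatorname{dom} f-\operatorname{dom} g)$ and $(0,0)\notin\operatorname{qri}(E)$; - $(RC_7^F)$: $0\in\operatorname{qi}[(\operatorname{dom} f-\operatorname{dom} g)-(\operatorname{dom} f-\operatorname{dom} g)]$, $0\in\operatorname{qri}(\operatorname{dom} f-\operatorname{dom} g)$ and $(0,0)\notin\operatorname{qri}(E)$. Then $(RC_1^F)\Rightarrow(RC_2^F)\Leftrightarrow(RC_3^F)$. If, moreover, $v(P_F)\in\mathbb R$, then also $(RC_3^F)\Rightarrow(RC_6^F)\Leftrightarrow(RC_7^F)$. -/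

import Mathlib

namespace FenchelRC

open Set Topology Uniformity
open scoped Pointwise

/-- A real topological vector space (with its translation-invariant uniformity) is a Fréchet space
if it is Hausdorff, locally convex, metrizable (countably generated uniformity) and complete. -/
def IsFrechetSpace (X : Type*) [AddCommGroup X] [Module ℝ X] [UniformSpace X]
    [IsUniformAddGroup X] [ContinuousSMul ℝ X] : Prop :=
  T2Space X ∧ LocallyConvexSpace ℝ X ∧ (𝓤 X).IsCountablyGenerated ∧ CompleteSpace X

/-! ### Extended real valued functions -/

/-- `dom f = {x : f x < +∞}`. -/
def dom {X : Type*} (f : X → EReal) : Set X := {x | f x < ⊤}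

/-- `f` is proper: its domain is nonempty and it never takes the value `-∞`. -/
def IsProper {X : Type*} (f : X → EReal) : Prop := (dom f).Nonempty ∧ ∀ x, ⊥ < f x

/-- Convexity of `f : X → [-∞, +∞]`: `f (t x + (1 - t) y) ≤ t f x + (1 - t) f y` for all `x`, `y`
and `t ∈ [0, 1]`, with the conventions `(+∞) + (-∞) = +∞`, `0 * (+∞) = +∞` and `0 * (-∞) = 0`.
Under these conventions the right-hand side is `+∞` as soon as `f x = +∞` or `f y = +∞`, so only
`x, y ∈ dom f` matter, and there Mathlib's operations on `EReal` agree with the conventions. -/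
def IsConvexFun {X : Type*} [AddCommGroup X] [Module ℝ X] (f : X → EReal) : Prop :=
  ∀ x ∈ dom f, ∀ y ∈ dom f, ∀ t ∈ Icc (0 : ℝ) 1,
    f (t • x + (1 - t) • y) ≤ (t : EReal) * f x + ((1 - t : ℝ) : EReal) * f y

/-- The epigraph `{(x, r) ∈ X × ℝ : f x ≤ r}`. -/
def epi {X : Type*} (f : X → EReal) : Set (X × ℝ) := {p | f p.1 ≤ (p.2 : EReal)}

/-- The reflected epigraph `{(x, r) ∈ X × ℝ : (x, -r) ∈ epi f}`. -/
def epiHat {X : Type*} (f : X → EReal) : Set (X × ℝ) := {p | (p.1, -p.2) ∈ epi f}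

/-- The optimal value of the primal problem `inf_{x ∈ X} (f x + g x)`. -/
noncomputable def primalValue {X : Type*} (f g : X → EReal) : EReal := ⨅ x, (f x + g x)

/-! ### Generalized interiors (used for convex sets) -/

/-- The conic hull `⋃_{t ≥ 0} t U`. -/
def coneHull {X : Type*} [AddCommGroup X] [Module ℝ X] (U : Set X) : Set X :=
  {y | ∃ t : ℝ, 0 ≤ t ∧ ∃ u ∈ U, y = t • u}

/-- The algebraic interior: points `x ∈ U` with `cone (U - x) = X`. -/
def core {X : Type*} [AddCommGroup X] [Module ℝ X] (U : Set X) : Set X :=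
  {x | x ∈ U ∧ coneHull (U - {x}) = univ}

/-- The quasi interior: points `x ∈ U` with `cl (cone (U - x)) = X`. -/
def qi {X : Type*} [AddCommGroup X] [Module ℝ X] [TopologicalSpace X] (U : Set X) : Set X :=
  {x | x ∈ U ∧ closure (coneHull (U - {x})) = univ}

/-- The quasi-relative interior: points `x ∈ U` such that `cl (cone (U - x))` is a linear
subspace. -/
def qri {X : Type*} [AddCommGroup X] [Module ℝ X] [TopologicalSpace X] (U : Set X) : Set X :=
  {x | x ∈ U ∧ ∃ L : Submodule ℝ X, (L : Set X) = closure (coneHull (U - {x}))}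

/-! ### The regularity conditions

In what follows `-` between sets is the Minkowski (pointwise) difference. -/

/-- The set `epi f - epiHat (g - v)`, where `v` is the primal optimal value. -/
def epiDiff {X : Type*} [AddCommGroup X] (f g : X → EReal) : Set (X × ℝ) :=
  epi f - epiHat (fun x => g x - primalValue f g)

/-- There is a point of `dom f ∩ dom g` at which `f` or `g` is continuous. -/
def RC1 {X : Type*} [TopologicalSpace X] (f g : X → EReal) : Prop :=
  ∃ x ∈ dom f ∩ dom g, ContinuousAt f x ∨ ContinuousAt g x

/-- `X` is Fréchet, `f` and `g` are lsc and `0 ∈ int (dom f - dom g)`. -/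
def RC2 {X : Type*} [AddCommGroup X] [Module ℝ X] [UniformSpace X]
    [IsUniformAddGroup X] [ContinuousSMul ℝ X] (f g : X → EReal) : Prop :=
  IsFrechetSpace X ∧ LowerSemicontinuous f ∧ LowerSemicontinuous g ∧
    (0 : X) ∈ interior (dom f - dom g)

/-- `X` is Fréchet, `f` and `g` are lsc and `0 ∈ core (dom f - dom g)`. -/
def RC3 {X : Type*} [AddCommGroup X] [Module ℝ X] [UniformSpace X]
    [IsUniformAddGroup X] [ContinuousSMul ℝ X] (f g : X → EReal) : Prop :=
  IsFrechetSpace X ∧ LowerSemicontinuous f ∧ LowerSemicontinuous g ∧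
    (0 : X) ∈ core (dom f - dom g)

/-- `0 ∈ qi (dom f - dom g)` and `(0,0) ∉ qri [co ((epi f - epiHat (g - v)) ∪ {(0,0)})]`. -/
def RC6 {X : Type*} [AddCommGroup X] [Module ℝ X] [TopologicalSpace X] (f g : X → EReal) : Prop :=
  (0 : X) ∈ qi (dom f - dom g) ∧
    (0 : X × ℝ) ∉ qri (convexHull ℝ (epiDiff f g ∪ {0}))

/-- `0 ∈ qi [(dom f - dom g) - (dom f - dom g)]`, `0 ∈ qri (dom f - dom g)` and
`(0,0) ∉ qri [co ((epi f - epiHat (g - v)) ∪ {(0,0)})]`. -/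
def RC7 {X : Type*} [AddCommGroup X] [Module ℝ X] [TopologicalSpace X] (f g : X → EReal) : Prop :=
  (0 : X) ∈ qi ((dom f - dom g) - (dom f - dom g)) ∧ (0 : X) ∈ qri (dom f - dom g) ∧
    (0 : X × ℝ) ∉ qri (convexHull ℝ (epiDiff f g ∪ {0}))

end FenchelRC

/-! Continuity at a common domain point makes one domain a neighbourhood of that point, which gives
`RC2`. The substance is `RC3` → `RC2`: for large `M` the closed convex set of pairs `(u, y)` with `f
(u + y) ≤ M` and `g y ≤ M` has absorbing projection to `u`, so by Ursescu's theorem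
(`fst_image_mem_nhds_zero`) the projection is a neighbourhood of 0. The uniform bound `M` also
yields `RC6`: were the cone of `E` dense in a subspace, that subspace would contain `(0, -ρ)`, and
averaging a nearby cone point with sublevel points in the opposite direction would beat the primal
value. The equivalence of `RC6` and `RC7` is pure cone algebra (`zero_mem_qi_iff`). -/

namespace FenchelRC

open Set Topology Uniformity Filter
open scoped Pointwise

/-! ### Projections of closed convex sets: Baire category and Ursescu's theorem. -/

section ClosedConvex

variable {Y W : Type*} [AddCommGroup Y] [Module ℝ Y] [TopologicalSpace Y]
  [AddCommGroup W] [Module ℝ W]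

/-- In a Baire topological vector space, the closure of a convex absorbing set is a neighbourhood
of the origin. -/
theorem closure_mem_nhds_zero_of_absorbing [IsTopologicalAddGroup Y] [ContinuousSMul ℝ Y]
    [BaireSpace Y] {S : Set Y} (hS : Convex ℝ S)
    (habs : ∀ y : Y, ∃ t : ℝ, 0 < t ∧ t • y ∈ S) : closure S ∈ 𝓝 (0 : Y) := by
  have h0 : (0 : Y) ∈ S := by
    obtain ⟨t, _, h⟩ := habs 0
    simpa using h
  set A := closure S ∩ -closure S with hA
  have hAc : Convex ℝ A := hS.closure.inter hS.closure.neg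
  have hAcl : IsClosed A := isClosed_closure.inter isClosed_closure.neg
  have hA0 : (0 : Y) ∈ A := ⟨subset_closure h0, by simpa using subset_closure h0⟩
  have hscale : ∀ {T : Set Y}, Convex ℝ T → (0 : Y) ∈ T → ∀ {y : Y} {s t : ℝ}, 0 ≤ s → s ≤ t →
      0 < t → t • y ∈ T → s • y ∈ T := by
    intro T hT hT0 y s t hs hst ht hy
    have := hT.smul_mem_of_zero_mem hT0 hy (t := s / t) ⟨by positivity, (div_le_one ht).2 hst⟩
    rwa [smul_smul, div_mul_cancel₀ _ ht.ne'] at this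
  -- `A` is symmetric and absorbing, so its integer dilates cover the space and Baire applies.
  have hU : ⋃ n : ℕ, (fun y : Y => ((n : ℝ) + 1)⁻¹ • y) ⁻¹' A = univ := by
    refine eq_univ_of_forall fun y => ?_
    obtain ⟨t, ht, hty⟩ := habs y
    obtain ⟨s, hs, hsy⟩ := habs (-y)
    obtain ⟨n, hn⟩ := exists_nat_one_div_lt (lt_min ht hs)
    rw [one_div] at hn
    refine mem_iUnion.2 ⟨n, ?_, ?_⟩
    · exact subset_closure (hscale hS h0 (by positivity) (hn.le.trans (min_le_left _ _)) ht hty)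
    · have := hscale hS h0 (y := -y) (s := ((n : ℝ) + 1)⁻¹) (by positivity)
        (hn.le.trans (min_le_right _ _)) hs hsy
      rw [smul_neg] at this
      exact subset_closure this
  obtain ⟨n, y, hy⟩ := nonempty_interior_of_iUnion_of_closed
    (fun n : ℕ => hAcl.preimage (continuous_const_smul (((n : ℝ) + 1)⁻¹) : Continuous
      (fun y : Y => ((n : ℝ) + 1)⁻¹ • y))) hU
  have hn : ((n : ℝ) + 1)⁻¹ ≠ 0 := by positivity
  have hz : ∀ᶠ x in 𝓝 (0 : Y), ((n : ℝ) + 1)⁻¹ • (y + x) ∈ A := by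
    have ht : Tendsto (fun x : Y => y + x) (𝓝 0) (𝓝 y) := by
      have : Continuous fun x : Y => y + x := by fun_prop
      simpa using this.tendsto 0
    exact ht (mem_interior_iff_mem_nhds.1 hy)
  have hyA : ((n : ℝ) + 1)⁻¹ • y ∈ A := by simpa using hz.self_of_nhds
  have hynA : -(((n : ℝ) + 1)⁻¹ • y) ∈ A := by
    refine ⟨hyA.2, ?_⟩
    simpa using hyA.1
  have hhalf : Tendsto (fun x : Y => (2 * ((n : ℝ) + 1)) • x) (𝓝 0) (𝓝 0) := by
    have : Continuous fun x : Y => (2 * ((n : ℝ) + 1)) • x := by fun_prop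
    simpa using this.tendsto 0
  filter_upwards [hhalf.eventually hz] with x hx
  have := hAc hx hynA (a := 1 / 2) (b := 1 / 2) (by norm_num) (by norm_num) (by norm_num)
  have hxA : x ∈ A := by
    convert this using 1
    rw [smul_add, smul_smul _ _ x, smul_add, smul_smul _ _ x, smul_neg]
    have : (1 / 2 : ℝ) * (((n : ℝ) + 1)⁻¹ * (2 * ((n : ℝ) + 1))) = 1 := by
      field_simp
    rw [this, one_smul]
    abel
  exact hxA.1

variable [IsTopologicalAddGroup Y] [ContinuousSMul ℝ Y] [BaireSpace Y]
  [FirstCountableTopology Y] [UniformSpace W] [IsUniformAddGroup W] [ContinuousSMul ℝ W]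
  [LocallyConvexSpace ℝ W] [CompleteSpace W] [(𝓤 W).IsCountablyGenerated]

/-- Open mapping argument: slices of `C` with small second coordinate still have absorbing
projections, so the closures of these are neighbourhoods of 0. Successive approximation removes the
closure, with completeness of `W` supplying the second coordinate. -/
theorem fst_image_mem_nhds_zero_of_zero_mem {C : Set (Y × W)} (hcl : IsClosed C)
    (hC : Convex ℝ C) (h0 : (0 : Y × W) ∈ C)
    (habs : ∀ y : Y, ∃ t : ℝ, 0 < t ∧ t • y ∈ Prod.fst '' C) :
    Prod.fst '' C ∈ 𝓝 (0 : Y) := by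
  let _ := UniformSpace.pseudoMetricSpace W
  have hV : ∀ n : ℕ, ∃ V : Set W, V ∈ 𝓝 (0 : W) ∧ Convex ℝ V ∧
      ∀ s t : W, t - s ∈ V → dist s t ≤ 1 / 2 / 2 ^ n := by
    intro n
    have hd : {p : W × W | dist p.1 p.2 < 1 / 2 / 2 ^ n} ∈ 𝓤 W :=
      Metric.dist_mem_uniformity (by positivity)
    rw [uniformity_eq_comap_nhds_zero W] at hd
    obtain ⟨N, hN, hNd⟩ := hd
    obtain ⟨V, ⟨hV0, hVc⟩, hVN⟩ := (LocallyConvexSpace.convex_basis_zero ℝ W).mem_iff.1 hN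
    exact ⟨V, hV0, hVc, fun s t h => (hNd (a := (s, t)) (hVN h)).le⟩
  choose V hV0 hVc hVd using hV
  let R : ℕ → Set Y := fun n => Prod.fst '' (C ∩ Prod.snd ⁻¹' V n)
  have hRc : ∀ n, Convex ℝ (R n) := fun n =>
    (hC.inter ((hVc n).linear_preimage (LinearMap.snd ℝ Y W))).linear_image (LinearMap.fst ℝ Y W)
  have hR : ∀ n, closure (R n) ∈ 𝓝 (0 : Y) := by
    intro n
    refine closure_mem_nhds_zero_of_absorbing (hRc n) fun y => ?_
    obtain ⟨t, ht, ⟨p, hp, hpy⟩⟩ := habs y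
    have h1 : Tendsto (fun s : ℝ => s • p.2) (𝓝[>] 0) (𝓝 0) := by
      have : Continuous fun s : ℝ => s • p.2 := by fun_prop
      simpa using (this.tendsto 0).mono_left nhdsWithin_le_nhds
    obtain ⟨s, hsV, hs⟩ := ((h1.eventually_mem (hV0 n)).and (Ioo_mem_nhdsGT (zero_lt_one' ℝ))).exists
    refine ⟨s * t, mul_pos hs.1 ht, s • p,
      ⟨hC.smul_mem_of_zero_mem h0 hp ⟨hs.1.le, hs.2.le⟩, hsV⟩, ?_⟩
    rw [Prod.smul_fst, hpy, smul_smul]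
  obtain ⟨B, hB⟩ := (𝓝 (0 : Y)).exists_antitone_basis
  have htwo : ∀ {N : Set Y}, N ∈ 𝓝 (0 : Y) → ∀ᶠ z in 𝓝 (0 : Y), (2 : ℝ) • z ∈ N := by
    intro N hN
    have : Tendsto (fun x : Y => (2 : ℝ) • x) (𝓝 0) (𝓝 0) := by
      have : Continuous fun x : Y => (2 : ℝ) • x := by fun_prop
      simpa using this.tendsto 0
    exact this hN
  -- The remainder is doubled at each stage so that the correction at stage `n` enters with weight
  -- `1 / 2 ^ (n + 1)`; membership in `B n` makes the rescaled remainders tend to 0.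
  have hstep : ∀ (n : ℕ) (z : Y), (2 : ℝ) • z ∈ closure (R n) → ∃ p : Y × W,
      p ∈ C ∧ p.2 ∈ V n ∧ (2 : ℝ) • ((2 : ℝ) • z - p.1) ∈ closure (R (n + 1)) ∧
        (2 : ℝ) • z - p.1 ∈ B n := by
    intro n z hz
    have ht : Tendsto (fun y : Y => (2 : ℝ) • z - y) (𝓝 ((2 : ℝ) • z)) (𝓝 0) := by
      have : Continuous fun y : Y => (2 : ℝ) • z - y := by fun_prop
      simpa using this.tendsto ((2 : ℝ) • z)
    obtain ⟨y, ⟨hy1, hy2⟩, p, ⟨hpC, hpV⟩, rfl⟩ := mem_closure_iff_nhds.1 hz _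
      (ht (inter_mem (htwo (hR (n + 1))) (hB.1.mem_of_mem trivial : B n ∈ 𝓝 0)))
    exact ⟨p, hpC, hpV, hy1, hy2⟩
  choose! P hPC hPV hPR hPB using hstep
  filter_upwards [htwo (hR 0)] with y hy
  let z : ℕ → Y := fun n => Nat.rec y (fun n z => (2 : ℝ) • z - (P n z).1) n
  have hz0 : z 0 = y := rfl
  have hzs : ∀ n, z (n + 1) = (2 : ℝ) • z n - (P n (z n)).1 := fun n => rfl
  have hz : ∀ n, (2 : ℝ) • z n ∈ closure (R n) := by
    intro n
    induction n with
    | zero => exact hy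
    | succ n ih => exact hPR n _ ih
  let c : ℕ → ℝ := fun n => (1 / 2) ^ n
  have hcs : ∀ n, c (n + 1) = 1 / 2 * c n := fun n => pow_succ' _ _
  have hcp : ∀ n, 0 < c n := fun n => by positivity
  have hc1 : ∀ n, c n ≤ 1 := fun n => pow_le_one₀ (by norm_num) (by norm_num)
  let S : ℕ → Y × W := fun n => ∑ k ∈ Finset.range n, c (k + 1) • P k (z k)
  have hSs : ∀ n, S (n + 1) = S n + c (n + 1) • P n (z n) := fun n => Finset.sum_range_succ _ _
  have hS1 : ∀ n, (S n).1 = y - c n • z n := by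
    intro n
    induction n with
    | zero => simp [S, c, hz0]
    | succ n ih =>
      rw [hSs, Prod.fst_add, ih, Prod.smul_fst, hzs, smul_sub, smul_smul]
      have : c (n + 1) * 2 = c n := by rw [hcs]; ring
      rw [this]
      abel
  -- The weights in `S n` sum to `1 - c n`; any point of `C` may fill the missing weight.
  have hSC : ∀ n, ∀ q ∈ C, S n + c n • q ∈ C := by
    intro n
    induction n with
    | zero => intro q hq; simpa [S, c] using hq
    | succ n ih =>
      intro q hq
      have hm := hC (hPC n _ (hz n)) hq (a := 1 / 2) (b := 1 / 2) (by norm_num) (by norm_num)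
        (by norm_num)
      convert ih _ hm using 1
      rw [hSs, hcs, smul_add, smul_smul, smul_smul, add_assoc, mul_comm (c n)]
  have hSC' : ∀ n, S n ∈ C := fun n => by simpa using hSC n 0 h0
  have hcauchy : CauchySeq fun n => (S n).2 := by
    refine cauchySeq_of_le_geometric_two (C := 1) fun n => hVd n _ _ ?_
    rw [hSs, Prod.snd_add, add_sub_cancel_left, Prod.smul_snd]
    exact (hVc n).smul_mem_of_zero_mem (mem_of_mem_nhds (hV0 n)) (hPV n _ (hz n))
      ⟨(hcp _).le, hc1 _⟩
  obtain ⟨w, hw⟩ := cauchySeq_tendsto_of_complete hcauchy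
  have hzt : Tendsto z atTop (𝓝 0) := by
    rw [← tendsto_add_atTop_iff_nat 1]
    exact hB.tendsto fun n => by rw [hzs]; exact hPB n _ (hz n)
  have hct : Tendsto c atTop (𝓝 0) :=
    tendsto_pow_atTop_nhds_zero_of_lt_one (by norm_num) (by norm_num)
  have hS1t : Tendsto (fun n => (S n).1) atTop (𝓝 y) := by
    simp only [hS1]
    simpa using tendsto_const_nhds.sub (hct.smul hzt)
  exact ⟨(y, w), hcl.mem_of_tendsto (hS1t.prodMk_nhds hw) (Eventually.of_forall hSC'), rfl⟩

/-- **Ursescu's theorem** at the origin: if the projection of a closed convex set along a complete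
metrizable locally convex space is absorbing, then it is a neighbourhood of the origin. -/
theorem fst_image_mem_nhds_zero {C : Set (Y × W)} (hcl : IsClosed C) (hC : Convex ℝ C)
    (habs : ∀ y : Y, ∃ t : ℝ, 0 < t ∧ t • y ∈ Prod.fst '' C) :
    Prod.fst '' C ∈ 𝓝 (0 : Y) := by
  obtain ⟨t, _, ⟨p, hp, hp0⟩⟩ := habs 0
  rw [smul_zero] at hp0
  -- `p` has first coordinate 0, so translating by it moves the origin into `C` without changing the
  -- projection.
  have himg : Prod.fst '' ((fun q => p + q) ⁻¹' C) = Prod.fst '' C := by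
    ext y
    constructor
    · rintro ⟨q, hq, rfl⟩
      exact ⟨p + q, hq, by simp [hp0]⟩
    · rintro ⟨q, hq, rfl⟩
      exact ⟨q - p, by simpa using hq, by simp [hp0]⟩
  rw [← himg]
  refine fst_image_mem_nhds_zero_of_zero_mem (hcl.preimage (by fun_prop))
    (hC.translate_preimage_right p) (by simpa using hp) ?_
  rwa [himg]

end ClosedConvex

/-! ### Real bounds for extended-real functions and the epigraph difference. -/

section ExtendedReal

variable {X : Type*}

theorem exists_coe_ge_of_mem_dom {f : X → EReal} {x : X} (hx : x ∈ dom f) :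
    ∃ a : ℝ, f x ≤ a := by
  obtain ⟨a, ha, _⟩ := EReal.lt_iff_exists_real_btwn.1 (show f x < ⊤ from hx)
  exact ⟨a, ha.le⟩

theorem mem_dom_of_le_coe {f : X → EReal} {x : X} {a : ℝ} (h : f x ≤ a) : x ∈ dom f :=
  h.trans_lt (EReal.coe_lt_top a)

theorem primalValue_le_add {f g : X → EReal} {v : ℝ} (hv : primalValue f g = v) {x : X}
    {a b : ℝ} (ha : f x ≤ a) (hb : g x ≤ b) : v ≤ a + b := by
  have : (v : EReal) ≤ a + b := by
    rw [← hv]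
    exact (iInf_le _ x).trans (add_le_add ha hb)
  exact_mod_cast this

variable [AddCommGroup X]

theorem mem_epiDiff_iff {f g : X → EReal} {v : ℝ} (hv : primalValue f g = v) {p : X × ℝ} :
    p ∈ epiDiff f g ↔ ∃ x y : X, ∃ a b : ℝ, f x ≤ a ∧ g y ≤ b ∧ p = (x - y, a + b - v) := by
  have key : ∀ (y : X) (s : ℝ), (y, s) ∈ epiHat (fun x => g x - primalValue f g) ↔
      g y ≤ ((v - s : ℝ) : EReal) := by
    intro y s
    change g y - primalValue f g ≤ ((-s : ℝ) : EReal) ↔ _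
    rw [hv, EReal.sub_le_iff_le_add (by simp) (by simp), ← EReal.coe_add]
    rw [show -s + v = v - s by ring]
  constructor
  · rintro ⟨⟨x, a⟩, hx, ⟨y, s⟩, hy, rfl⟩
    refine ⟨x, y, a, v - s, hx, (key y s).1 hy, ?_⟩
    simp only [Prod.mk_sub_mk, Prod.mk.injEq, true_and]
    ring
  · rintro ⟨x, y, a, b, hx, hy, rfl⟩
    refine ⟨(x, a), hx, (y, v - b), (key _ _).2 (by simpa using hy), ?_⟩
    simp only [Prod.mk_sub_mk, Prod.mk.injEq, true_and]
    ring

variable [Module ℝ X]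

theorem IsConvexFun.le_combo {f : X → EReal} (hf : IsConvexFun f) {x y : X} {a b : ℝ}
    (hx : f x ≤ a) (hy : f y ≤ b) {s t : ℝ} (hs : 0 ≤ s) (ht : 0 ≤ t) (hst : s + t = 1) :
    f (s • x + t • y) ≤ ((s * a + t * b : ℝ) : EReal) := by
  obtain rfl : t = 1 - s := by linarith
  refine (hf x (mem_dom_of_le_coe hx) y (mem_dom_of_le_coe hy) s ⟨hs, by linarith⟩).trans ?_
  rw [EReal.coe_add, EReal.coe_mul, EReal.coe_mul]
  exact add_le_add (mul_le_mul_of_nonneg_left hx (by exact_mod_cast hs))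
    (mul_le_mul_of_nonneg_left hy (by exact_mod_cast ht))

theorem IsConvexFun.convex_sublevel {f : X → EReal} (hf : IsConvexFun f) (M : ℝ) :
    Convex ℝ {x | f x ≤ M} := by
  intro x hx y hy s t hs ht hst
  have := hf.le_combo hx hy hs ht hst
  rwa [← add_mul, hst, one_mul] at this

theorem convex_epiDiff {f g : X → EReal} (hf : IsConvexFun f) (hg : IsConvexFun g) {v : ℝ}
    (hv : primalValue f g = v) : Convex ℝ (epiDiff f g) := by
  intro p hp q hq s t hs ht hst
  rw [mem_epiDiff_iff hv] at hp hq ⊢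
  obtain ⟨x, y, a, b, hx, hy, rfl⟩ := hp
  obtain ⟨x', y', a', b', hx', hy', rfl⟩ := hq
  refine ⟨_, _, _, _, hf.le_combo hx hx' hs ht hst, hg.le_combo hy hy' hs ht hst, ?_⟩
  ext
  · simp only [Prod.smul_mk, Prod.mk_add_mk]
    module
  · simp only [Prod.smul_mk, Prod.mk_add_mk, smul_eq_mul]
    linear_combination (-v) * hst

end ExtendedReal

/-! ### Conic hulls and generalized interiors. -/

section Cones

variable {X : Type*} [AddCommGroup X] [Module ℝ X]

theorem coneHull_mono {S T : Set X} (h : S ⊆ T) : coneHull S ⊆ coneHull T := by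
  rintro _ ⟨t, ht, u, hu, rfl⟩
  exact ⟨t, ht, u, h hu, rfl⟩

theorem subset_coneHull (S : Set X) : S ⊆ coneHull S := fun u hu =>
  ⟨1, zero_le_one, u, hu, (one_smul ℝ u).symm⟩

theorem coneHull_subset_submodule {S : Set X} {L : Submodule ℝ X} (h : S ⊆ L) :
    coneHull S ⊆ L := by
  rintro _ ⟨t, _, u, hu, rfl⟩
  exact L.smul_mem t (h hu)

/-- Adjoining 0 to a convex set only adds segments to the origin, hence no new rays. -/
theorem exists_smul_of_mem_coneHull_convexHull {S : Set X} (hS : Convex ℝ S)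
    (hne : S.Nonempty) {p : X} (hp : p ∈ coneHull (convexHull ℝ (S ∪ {0}))) :
    ∃ t : ℝ, 0 ≤ t ∧ ∃ e ∈ S, p = t • e := by
  obtain ⟨t, ht, u, hu, rfl⟩ := hp
  rw [union_singleton, convexHull_insert hne, hS.convexHull_eq, mem_convexJoin] at hu
  obtain ⟨_, rfl, e, he, a, b, ha, hb, _, rfl⟩ := hu
  exact ⟨t * b, mul_nonneg ht hb, e, he, by rw [smul_zero, zero_add, smul_smul]⟩

theorem exists_pos_smul_mem_of_zero_mem_core {S : Set X} (h : (0 : X) ∈ core S) (y : X) :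
    ∃ t : ℝ, 0 < t ∧ t • y ∈ S := by
  obtain ⟨h0, hc⟩ := h
  rw [singleton_zero, sub_zero] at hc
  obtain ⟨t, ht, u, hu, rfl⟩ : y ∈ coneHull S := hc ▸ mem_univ y
  rcases ht.eq_or_lt with rfl | ht
  · exact ⟨1, one_pos, by simpa using h0⟩
  · exact ⟨t⁻¹, inv_pos.2 ht, by rwa [smul_smul, inv_mul_cancel₀ ht.ne', one_smul]⟩

variable [TopologicalSpace X]

theorem zero_mem_core_of_mem_nhds [ContinuousSMul ℝ X] {S : Set X} (h : S ∈ 𝓝 (0 : X)) :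
    (0 : X) ∈ core S := by
  refine ⟨mem_of_mem_nhds h, ?_⟩
  rw [singleton_zero, sub_zero]
  refine eq_univ_of_forall fun y => ?_
  have h1 : Tendsto (fun s : ℝ => s • y) (𝓝[>] 0) (𝓝 0) := by
    have : Continuous fun s : ℝ => s • y := by fun_prop
    simpa using (this.tendsto 0).mono_left nhdsWithin_le_nhds
  obtain ⟨s, hsS, hs⟩ := ((h1.eventually_mem h).and self_mem_nhdsWithin).exists
  have hs : 0 < s := hs
  exact ⟨s⁻¹, (inv_pos.2 hs).le, s • y, hsS, by rw [smul_smul, inv_mul_cancel₀ hs.ne', one_smul]⟩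

theorem core_subset_qi (S : Set X) : core S ⊆ qi S := fun _ hx =>
  ⟨hx.1, by rw [hx.2, closure_univ]⟩

/-- A closed subspace containing `S` contains `S - S` and its closed cone. -/
theorem zero_mem_qi_iff (S : Set X) : (0 : X) ∈ qi S ↔ (0 : X) ∈ qi (S - S) ∧ (0 : X) ∈ qri S := by
  simp only [qi, qri, mem_ofPred_eq, singleton_zero, sub_zero]
  constructor
  · rintro ⟨h0, h⟩
    refine ⟨⟨⟨0, h0, 0, h0, sub_zero 0⟩, ?_⟩, h0, ⊤, by rw [h, Submodule.top_coe]⟩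
    exact eq_univ_of_univ_subset
      (h ▸ closure_mono (coneHull_mono fun x hx => ⟨x, hx, 0, h0, sub_zero x⟩))
  · rintro ⟨⟨_, h⟩, h0, L, hL⟩
    refine ⟨h0, ?_⟩
    have hSL : S ⊆ L := hL ▸ (subset_coneHull S).trans subset_closure
    have hSS : S - S ⊆ L := by
      rintro _ ⟨x, hx, y, hy, rfl⟩
      exact L.sub_mem (hSL hx) (hSL hy)
    have hcl : IsClosed (L : Set X) := hL ▸ isClosed_closure
    rw [← hL]
    exact eq_univ_of_univ_subset (h ▸ closure_minimal (coneHull_subset_submodule hSS) hcl)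

end Cones

/-! ### The implications between the regularity conditions. -/

section Regularity

theorem dom_sub_dom_mem_nhds_zero {X : Type*} [AddCommGroup X] [TopologicalSpace X]
    [IsTopologicalAddGroup X] {f g : X → EReal} (h : RC1 f g) : dom f - dom g ∈ 𝓝 (0 : X) := by
  obtain ⟨x, ⟨hxf, hxg⟩, hc | hc⟩ := h
  · have ht : Tendsto (fun u : X => u + x) (𝓝 0) (𝓝 x) := by
      have : Continuous fun u : X => u + x := by fun_prop
      simpa using this.tendsto 0
    filter_upwards [ht (hc (Iio_mem_nhds hxf))] with u hu
    exact ⟨u + x, hu, x, hxg, add_sub_cancel_right u x⟩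
  · have ht : Tendsto (fun u : X => x - u) (𝓝 0) (𝓝 x) := by
      have : Continuous fun u : X => x - u := by fun_prop
      simpa using this.tendsto 0
    filter_upwards [ht (hc (Iio_mem_nhds hxg))] with u hu
    exact ⟨x, hxf, x - u, hu, sub_sub_cancel x u⟩

variable {X : Type*} [AddCommGroup X] [Module ℝ X]

/-- If `0 ∈ core (dom f - dom g)`, then differences of points from a common pair of sublevel sets
already fill a neighbourhood of the origin. -/
theorem exists_sublevel_sub_sublevel_mem_nhds_zero [UniformSpace X] [IsUniformAddGroup X]
    [ContinuousSMul ℝ X] (hX : IsFrechetSpace X) {f g : X → EReal}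
    (hfc : IsConvexFun f) (hgc : IsConvexFun g)
    (hfl : LowerSemicontinuous f) (hgl : LowerSemicontinuous g)
    (h : (0 : X) ∈ core (dom f - dom g)) :
    ∃ M : ℝ, {x | f x ≤ M} - {y | g y ≤ M} ∈ 𝓝 (0 : X) := by
  obtain ⟨_, _, _, _⟩ := hX
  obtain ⟨x₀, hxf, y₀, hxg, hxy⟩ := h.1
  obtain rfl : x₀ = y₀ := sub_eq_zero.1 hxy
  obtain ⟨a₀, ha₀⟩ := exists_coe_ge_of_mem_dom hxf
  obtain ⟨b₀, hb₀⟩ := exists_coe_ge_of_mem_dom hxg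
  -- The extra 1 leaves room to move slightly from `x₀` towards any domain points and stay below
  -- `M`.
  set M := max a₀ b₀ + 1 with hM
  refine ⟨M, ?_⟩
  let C : Set (X × X) := {p | f (p.1 + p.2) ≤ M} ∩ {p | g p.2 ≤ M}
  have hcl : IsClosed C :=
    ((hfl.isClosed_preimage M).preimage (continuous_fst.add continuous_snd)).inter
      ((hgl.isClosed_preimage M).preimage continuous_snd)
  have hC : Convex ℝ C :=
    ((hfc.convex_sublevel M).linear_preimage (LinearMap.fst ℝ X X + LinearMap.snd ℝ X X)).inter
      ((hgc.convex_sublevel M).linear_preimage (LinearMap.snd ℝ X X))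
  have himg : Prod.fst '' C ⊆ {x | f x ≤ M} - {y | g y ≤ M} := by
    rintro _ ⟨p, ⟨hp1, hp2⟩, rfl⟩
    exact ⟨p.1 + p.2, hp1, p.2, hp2, add_sub_cancel_right _ _⟩
  refine mem_of_superset (fst_image_mem_nhds_zero hcl hC fun u => ?_) himg
  obtain ⟨t, ht, x, hx, y, hy, hxyu⟩ := exists_pos_smul_mem_of_zero_mem_core h u
  obtain ⟨a, ha⟩ := exists_coe_ge_of_mem_dom hx
  obtain ⟨b, hb⟩ := exists_coe_ge_of_mem_dom hy
  have hlim : ∀ k l : ℝ, k < M → ∀ᶠ s : ℝ in 𝓝[>] 0, s * l + (1 - s) * k ≤ M := by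
    intro k l hk
    have hc : Continuous fun s : ℝ => s * l + (1 - s) * k := by fun_prop
    have : Tendsto (fun s : ℝ => s * l + (1 - s) * k) (𝓝[>] 0) (𝓝 k) := by
      simpa using (hc.tendsto 0).mono_left nhdsWithin_le_nhds
    exact this.eventually_le_const hk
  obtain ⟨s, ⟨hsa, hsb⟩, hs0, hs1⟩ :=
    (((hlim a₀ a ((le_max_left _ _).trans_lt (lt_add_one _))).and
      (hlim b₀ b ((le_max_right _ _).trans_lt (lt_add_one _)))).and
        (Ioo_mem_nhdsGT (zero_lt_one' ℝ))).exists
  have hfs := hfc.le_combo ha ha₀ hs0.le (sub_nonneg.2 hs1.le) (add_sub_cancel s 1)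
  have hgs := hgc.le_combo hb hb₀ hs0.le (sub_nonneg.2 hs1.le) (add_sub_cancel s 1)
  refine ⟨s * t, mul_pos hs0 ht, ((s * t) • u, s • y + (1 - s) • x₀), ⟨?_, ?_⟩, rfl⟩
  · have : (s * t) • u + (s • y + (1 - s) • x₀) = s • x + (1 - s) • x₀ := by
      rw [mul_smul, ← hxyu]
      simp only
      module
    change f ((s * t) • u + (s • y + (1 - s) • x₀)) ≤ M
    rw [this]
    exact hfs.trans (by exact_mod_cast hsa)
  · exact hgs.trans (by exact_mod_cast hsb)

theorem zero_notMem_qri_convexHull_epiDiff [TopologicalSpace X]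
    [ContinuousSMul ℝ X] {f g : X → EReal}
    (hfc : IsConvexFun f) (hgc : IsConvexFun g) {v : ℝ} (hv : primalValue f g = v) {M : ℝ}
    (hM : {x | f x ≤ M} - {y | g y ≤ M} ∈ 𝓝 (0 : X)) :
    (0 : X × ℝ) ∉ qri (convexHull ℝ (epiDiff f g ∪ {0})) := by
  rintro ⟨_, L, hL⟩
  rw [singleton_zero, sub_zero] at hL
  obtain ⟨x₀, hx₀, y₀, hy₀, hxy⟩ := mem_of_mem_nhds hM
  obtain rfl : x₀ = y₀ := sub_eq_zero.1 hxy
  -- Large enough both for `(0, ρ)` to lie in `epiDiff f g` and for the final contradiction.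
  set ρ := |M + M - v| + 1 with hρ
  have hρ0 : 0 < ρ := by positivity
  have hmem : ((0 : X), ρ) ∈ epiDiff f g := by
    rw [mem_epiDiff_iff hv]
    refine ⟨x₀, x₀, M, ρ + v - M, hx₀, hy₀.trans ?_, ?_⟩
    · have := le_abs_self (M + M - v)
      exact_mod_cast (by linarith : M ≤ ρ + v - M)
    · rw [sub_self]
      congr 1
      ring
  have hneg : ((0 : X), -ρ) ∈ closure (coneHull (convexHull ℝ (epiDiff f g ∪ {0}))) := by
    have h1 : ((0 : X), ρ) ∈ (L : Set (X × ℝ)) := hL ▸ subset_closure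
      (subset_coneHull _ (subset_convexHull ℝ _ (Or.inl hmem)))
    have h2 := L.neg_mem h1
    rw [Prod.neg_mk, neg_zero] at h2
    exact hL ▸ h2
  -- The factor 2 compensates for the height being known only below `-ρ / 2`.
  have hN : {p : X × ℝ | (-2 : ℝ) • p.1 ∈ {x | f x ≤ M} - {y | g y ≤ M} ∧ p.2 < -ρ / 2} ∈
      𝓝 ((0 : X), -ρ) := by
    have h1 : Tendsto (fun p : X × ℝ => (-2 : ℝ) • p.1) (𝓝 ((0 : X), -ρ)) (𝓝 0) := by
      have : Continuous fun p : X × ℝ => (-2 : ℝ) • p.1 := by fun_prop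
      simpa using this.tendsto ((0 : X), -ρ)
    exact inter_mem (h1 hM) (continuous_snd.continuousAt.eventually_lt_const (by
      change -ρ < -ρ / 2
      linarith))
  obtain ⟨p, ⟨⟨x, hx, y, hy, hxyp⟩, hp2⟩, hpc⟩ := mem_closure_iff_nhds.1 hneg _ hN
  obtain ⟨t, ht, e, he, rfl⟩ :=
    exists_smul_of_mem_coneHull_convexHull (convex_epiDiff hfc hgc hv) ⟨_, hmem⟩ hpc
  obtain ⟨x₁, y₁, a, b, ha, hb, rfl⟩ := (mem_epiDiff_iff hv).1 he
  simp only [Prod.smul_mk, smul_eq_mul] at hxyp hp2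
  have hd : 0 < 1 + 2 * t := by positivity
  have hst : 2 * t / (1 + 2 * t) + 1 / (1 + 2 * t) = 1 := by
    field_simp
    ring
  have hf' := hfc.le_combo ha hx (by positivity) (by positivity) hst
  have hg' := hgc.le_combo hb hy (by positivity) (by positivity) hst
  -- With these weights the two differences cancel, so `f` and `g` are bounded at one common point.
  have heq : (2 * t / (1 + 2 * t)) • x₁ + (1 / (1 + 2 * t)) • x =
      (2 * t / (1 + 2 * t)) • y₁ + (1 / (1 + 2 * t)) • y := by
    rw [← sub_eq_zero]
    have h1 : (2 * t) • (x₁ - y₁) + (x - y) = 0 := by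
      rw [hxyp]
      module
    have h2 := congrArg (fun z => (1 / (1 + 2 * t)) • z) h1
    rw [smul_zero] at h2
    rw [← h2]
    module
  rw [heq] at hf'
  have hle := primalValue_le_add hv hf' hg'
  have hle' : (1 + 2 * t) * v ≤ 2 * t * (a + b) + (M + M) := by
    have := mul_le_mul_of_nonneg_left hle hd.le
    refine this.trans (le_of_eq ?_)
    field_simp
    ring
  have := le_abs_self (M + M - v)
  nlinarith

end Regularity

end FenchelRC

theorem proposition5p4 {X : Type*} [AddCommGroup X] [Module ℝ X] [UniformSpace X]
    [IsUniformAddGroup X] [ContinuousSMul ℝ X] (hX : FenchelRC.IsFrechetSpace X)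
    (f g : X → EReal)
    (hf : FenchelRC.IsProper f) (hg : FenchelRC.IsProper g)
    (hfc : FenchelRC.IsConvexFun f) (hgc : FenchelRC.IsConvexFun g)
    (hfl : LowerSemicontinuous f) (hgl : LowerSemicontinuous g) :
    (FenchelRC.RC1 f g → FenchelRC.RC2 f g) ∧
    (FenchelRC.RC2 f g ↔ FenchelRC.RC3 f g) ∧
    ((∃ v : ℝ, FenchelRC.primalValue f g = (v : EReal)) →
      (FenchelRC.RC3 f g → FenchelRC.RC6 f g) ∧
      (FenchelRC.RC6 f g ↔ FenchelRC.RC7 f g)) := by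
  refine ⟨fun h => ⟨hX, hfl, hgl,
      mem_interior_iff_mem_nhds.2 (FenchelRC.dom_sub_dom_mem_nhds_zero h)⟩, ⟨?_, ?_⟩, ?_⟩
  · rintro ⟨_, _, _, h⟩
    exact ⟨hX, hfl, hgl, FenchelRC.zero_mem_core_of_mem_nhds (mem_interior_iff_mem_nhds.1 h)⟩
  · rintro ⟨_, _, _, h⟩
    obtain ⟨M, hM⟩ :=
      FenchelRC.exists_sublevel_sub_sublevel_mem_nhds_zero hX hfc hgc hfl hgl h
    exact ⟨hX, hfl, hgl, mem_interior_iff_mem_nhds.2 (Filter.mem_of_superset hM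
      (Set.sub_subset_sub (fun _ => FenchelRC.mem_dom_of_le_coe)
        (fun _ => FenchelRC.mem_dom_of_le_coe)))⟩
  · rintro ⟨v, hv⟩
    refine ⟨?_, ?_⟩
    · rintro ⟨_, _, _, h⟩
      obtain ⟨M, hM⟩ :=
        FenchelRC.exists_sublevel_sub_sublevel_mem_nhds_zero hX hfc hgc hfl hgl h
      exact ⟨FenchelRC.core_subset_qi _ h,
        FenchelRC.zero_notMem_qri_convexHull_epiDiff hfc hgc hv hM⟩
    · rw [FenchelRC.RC6, FenchelRC.RC7, FenchelRC.zero_mem_qi_iff, and_assoc]
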